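/- Let $\Gamma_\bullet=\{\Gamma_k:\mathcal M_{k-1}\to\mathcal M_k\}_{k\ge 1}$ be a sequence of $*$-linear bi-faithful functors (the functor and its adjoint are faithful) between finite semisimple C*-categories, i.e. a $0$-cell of the 2-category $\mathbf{UC}$ of unitary connections. A $1$-cell $\Gamma_\bullet\to\Gamma_\bullet$ is a sequence of $*$-linear bi-faithful functors $Q_k:\mathcal M_k\to\mathcal M_k$ $(k\ge 0)$ with natural unitaries $W_k:\Gamma_kQ_{k-1}\to Q_k\Gamma_k$ $(k\ge1)$; the tensor product $\boxtimes$ of $1$-cells is levelwise composition of functors, with the composite connections. A $2$-cell $(\Lambda_\bullet,W^\Lambda_\bullet)\to(\Omega_\bullet,W^\Omega_\bullet)$ is represented by a sequence of natural transformations $\eta_k:\Lambda_k\to\Omega_k$ which for all large $k$ satisfy the exchange relation $W^{\Omega}_{k+1}\circ\Gamma_{k+1}(\eta_k)=(\eta_{k+1})_{\Gamma_{k+1}}\circ W^{\Lambda}_{k+1}$; sequences that are eventually equal represent the same $2$-cell. Let $(Q_\bullet,m_\bullet,i_\bullet)$ be a Q-system on $\Gamma_\bullet$, with $2$-cells $m_\bullet:Q_\bullet\boxtimes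 Q_\bullet\to Q_\bullet$ and $i_\bullet:1\to Q_\bullet$ such that the following hold for all large $k$: $$m_k\circ (m_k)_{Q_k}=m_k\circ Q_k(m_k),\qquad m_k\circ (i_k)_{Q_k}=1_{Q_k}=m_k\circ Q_k(i_k),$$ $$(m_k)_{Q_k}\circ Q_k(m_k^*)=m_k^*\circ m_k=Q_k(m_k)\circ (m_k^*)_{Q_k},\qquad m_k\circ m_k^*=1_{Q_k}.$$ Fix $l$ such that for all $k\ge l$ these axioms hold at level $k$ and the pairs $(m_k,m_{k+1})$ and $(i_k,i_{k+1})$ satisfy the exchange relation. Let $m_0\in\mathcal M_0$ be the direct sum of a maximal set of mutually non-isomorphic simple objects, and put $x_k=\Gamma_k\cdots\Gamma_1m_0$, $A_k=\mathrm{End}(x_k)$ and $H_k=\mathcal M_k(x_k,Q_kx_k)$. The space $H_k$ is an $A_k$-$A_k$-bimodule via $a\cdot\xi\cdot b=Q_k(a)\circ\xi\circ b$, and $\widetilde m_k:H_k\boxtimes_{A_k}H_k\to H_k$ is the linear map $\widetilde m_k(\xi\boxtimes\eta)=(m_k)_{x_k}\circ Q_k(\xi)\circ\eta$. **Proposition.**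 For each $k\ge l$, the vector space $H_k$ is a unital C*-algebra with multiplication, involution and unit $$\xi\cdot\eta=\widetilde m_k(\xi\boxtimes\eta),\qquad \xi^\dagger=Q_k(\xi^*)\circ (m_k)_{x_k}^*\circ (i_k)_{x_k},\qquad 1_{H_k}=(i_k)_{x_k}.$$ Moreover, $$S_k=\{x\in\mathrm{End}(Q_kx_k)\ :\ (m_k)_{x_k}\circ Q_k(x)=x\circ (m_k)_{x_k}\}$$ is a unital $*$-subalgebra of the finite-dimensional C*-algebra $\mathrm{End}(Q_kx_k)$, and the maps $\phi_1^{(k)}:H_k\to S_k$, $\xi\mapsto (m_k)_{x_k}\circ Q_k(\xi)$, and $\phi_2^{(k)}:S_k\to H_k$, $x\mapsto x\circ (i_k)_{x_k}$, are mutually inverse unital $*$-isomorphisms, isometric for the norm of $\mathrm{End}(Q_kx_k)$ on $S_k$. -/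

import Mathlib

open CategoryTheory
open scoped TensorProduct

universe u v

namespace UC

/-! ### C*-categories -/

/-- A C*-category: a `ℂ`-linear category with a conjugate-linear involution `adj` on morphisms and
complete norms on its morphism spaces satisfying the C*-identity, in which `f* ∘ f` is a positive
element of `End X` for every `f : X ⟶ Y`. -/
class CStarCategory (C : Type u) [Category.{v} C] extends Preadditive C, Linear ℂ C where
  adj : ∀ {X Y : C}, (X ⟶ Y) → (Y ⟶ X)
  adj_adj : ∀ {X Y : C} (f : X ⟶ Y), adj (adj f) = f
  adj_comp : ∀ {X Y Z : C} (f : X ⟶ Y) (g : Y ⟶ Z), adj (f ≫ g) = adj g ≫ adj f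
  adj_add : ∀ {X Y : C} (f g : X ⟶ Y), adj (f + g) = adj f + adj g
  adj_smul : ∀ {X Y : C} (c : ℂ) (f : X ⟶ Y), adj (c • f) = (starRingEnd ℂ c) • adj f
  /-- The norm of a morphism. -/
  hnorm : ∀ {X Y : C}, (X ⟶ Y) → ℝ
  hnorm_add_le : ∀ {X Y : C} (f g : X ⟶ Y), hnorm (f + g) ≤ hnorm f + hnorm g
  hnorm_smul : ∀ {X Y : C} (c : ℂ) (f : X ⟶ Y), hnorm (c • f) = ‖c‖ * hnorm f
  eq_zero_of_hnorm : ∀ {X Y : C} (f : X ⟶ Y), hnorm f = 0 → f = 0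
  hnorm_comp_le : ∀ {X Y Z : C} (f : X ⟶ Y) (g : Y ⟶ Z), hnorm (f ≫ g) ≤ hnorm f * hnorm g
  hnorm_comp_adj : ∀ {X Y : C} (f : X ⟶ Y), hnorm (f ≫ adj f) = hnorm f * hnorm f
  comp_adj_pos : ∀ {X Y : C} (f : X ⟶ Y), ∃ g : X ⟶ X, f ≫ adj f = g ≫ adj g
  complete : ∀ {X Y : C} (f : ℕ → (X ⟶ Y)),
    (∀ ε : ℝ, 0 < ε → ∃ N, ∀ p, N ≤ p → ∀ q, N ≤ q → hnorm (f p - f q) < ε) →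
    ∃ g : X ⟶ Y, ∀ ε : ℝ, 0 < ε → ∃ N, ∀ p, N ≤ p → hnorm (f p - g) < ε

section CStar

variable {C : Type u} [Category.{v} C] [CStarCategory C]

/-- The adjoint `f*` of a morphism `f` of a C*-category. -/
abbrev adj {X Y : C} (f : X ⟶ Y) : Y ⟶ X := CStarCategory.adj f

/-- The norm of a morphism of a C*-category. -/
abbrev hnorm {X Y : C} (f : X ⟶ Y) : ℝ := CStarCategory.hnorm f

/-- `End X` (with product `f * g = f ∘ g`) is a unital `*`-algebra with involution `adj`. -/
instance (X : C) : StarRing (End X) where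
  star f := adj (X := X) (Y := X) f
  star_involutive f := CStarCategory.adj_adj (X := X) (Y := X) f
  star_mul f g := CStarCategory.adj_comp (X := X) (Y := X) (Z := X) g f
  star_add f g := CStarCategory.adj_add (X := X) (Y := X) f g

instance (X : C) : StarModule ℂ (End X) where
  star_smul c f := CStarCategory.adj_smul (X := X) (Y := X) c f

/-- `X` is the orthogonal direct sum of the objects `s j`. -/
def IsOrthogonalSum {n : ℕ} (s : Fin n → C) (X : C) : Prop :=
  ∃ ι : ∀ j, s j ⟶ X, (∀ j, ι j ≫ adj (ι j) = 𝟙 (s j)) ∧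
    (∀ j j', j ≠ j' → ι j ≫ adj (ι j') = 0) ∧ ∑ j, adj (ι j) ≫ ι j = 𝟙 X

/-- `X` is the direct sum of a maximal family of mutually non-isomorphic simple objects. -/
def IsSumOfAllSimples (X : C) : Prop :=
  ∃ (n : ℕ) (s : Fin n → C), (∀ j, Simple (s j)) ∧ (∀ j j', Nonempty (s j ≅ s j') → j = j') ∧
    (∀ Y : C, Simple Y → ∃ j, Nonempty (Y ≅ s j)) ∧ IsOrthogonalSum s X

end CStar

/-- A finite semisimple C*-category. -/
class FiniteSemisimple (C : Type u) [Category.{v} C] [CStarCategory C] : Prop where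
  finiteDimensional : ∀ X Y : C, FiniteDimensional ℂ (X ⟶ Y)
  /-- Finite orthogonal direct sums exist (`n = 0` gives a zero object). -/
  exists_sum : ∀ (n : ℕ) (s : Fin n → C), ∃ X : C, IsOrthogonalSum s X
  /-- Every projection splits. -/
  exists_split : ∀ (X : C) (p : X ⟶ X), p ≫ p = p → adj p = p →
    ∃ (Y : C) (w : Y ⟶ X), w ≫ adj w = 𝟙 Y ∧ adj w ≫ w = p
  /-- Every object is a finite orthogonal direct sum of simple objects. -/
  decompose : ∀ X : C, ∃ (n : ℕ) (s : Fin n → C), (∀ j, Simple (s j)) ∧ IsOrthogonalSum s X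
  /-- There are finitely many isomorphism classes of simple objects. -/
  finite_simples : ∃ (n : ℕ) (s : Fin n → C), (∀ j, Simple (s j)) ∧
    ∀ Y : C, Simple Y → ∃ j, Nonempty (Y ≅ s j)

section Functors

variable {C D E : Type u} [Category.{v} C] [Category.{v} D] [Category.{v} E]
  [CStarCategory C] [CStarCategory D] [CStarCategory E]

/-- A `*`-linear, bi-faithful functor: it is `ℂ`-linear, preserves adjoints of morphisms, and both
it and its adjoint functor are faithful. -/
structure IsStarBiFaithful (F : C ⥤ D) : Prop where
  map_add : ∀ {X Y : C} (f g : X ⟶ Y), F.map (f + g) = F.map f + F.map g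
  map_smul : ∀ {X Y : C} (c : ℂ) (f : X ⟶ Y), F.map (c • f) = c • F.map f
  map_adj : ∀ {X Y : C} (f : X ⟶ Y), F.map (adj f) = adj (F.map f)
  faithful : F.Faithful
  adjoint_faithful : ∃ G : D ⥤ C, Nonempty (F ⊣ G) ∧ G.Faithful

theorem IsStarBiFaithful.id : IsStarBiFaithful (𝟭 C) where
  map_add _ _ := rfl
  map_smul _ _ := rfl
  map_adj _ := rfl
  faithful := inferInstance
  adjoint_faithful := ⟨𝟭 C, ⟨Adjunction.id⟩, inferInstance⟩

theorem IsStarBiFaithful.comp {F : C ⥤ D} {G : D ⥤ E} (hF : IsStarBiFaithful F)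
    (hG : IsStarBiFaithful G) : IsStarBiFaithful (F ⋙ G) where
  map_add f g := by simp [hF.map_add, hG.map_add]
  map_smul c f := by simp [hF.map_smul, hG.map_smul]
  map_adj f := by simp [hF.map_adj, hG.map_adj]
  faithful := by
    have := hF.faithful
    have := hG.faithful
    infer_instance
  adjoint_faithful := by
    obtain ⟨F', ⟨a⟩, _⟩ := hF.adjoint_faithful
    obtain ⟨G', ⟨b⟩, _⟩ := hG.adjoint_faithful
    exact ⟨G' ⋙ F', ⟨a.comp b⟩, inferInstance⟩

/-- A unitary morphism. -/
def IsUnitary {X Y : C} (f : X ⟶ Y) : Prop := f ≫ adj f = 𝟙 X ∧ adj f ≫ f = 𝟙 Y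

theorem adj_id (X : C) : adj (𝟙 X) = 𝟙 X := by
  have h := CStarCategory.adj_comp (adj (𝟙 X)) (𝟙 X)
  rw [Category.comp_id, CStarCategory.adj_adj] at h
  simpa using h.symm

theorem IsUnitary.id (X : C) : IsUnitary (𝟙 X) := by
  constructor <;> simp only [adj_id, Category.comp_id]

theorem IsUnitary.comp {X Y Z : C} {f : X ⟶ Y} {g : Y ⟶ Z} (hf : IsUnitary f)
    (hg : IsUnitary g) : IsUnitary (f ≫ g) := by
  constructor
  · rw [adj, CStarCategory.adj_comp, Category.assoc, ← Category.assoc g, hg.1, Category.id_comp,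
      hf.1]
  · rw [adj, CStarCategory.adj_comp, Category.assoc, ← Category.assoc _ f, hf.2, Category.id_comp,
      hg.2]

theorem IsUnitary.map {F : C ⥤ D} (hF : IsStarBiFaithful F) {X Y : C} {f : X ⟶ Y}
    (hf : IsUnitary f) : IsUnitary (F.map f) := by
  constructor
  · rw [← hF.map_adj, ← F.map_comp, hf.1, F.map_id]
  · rw [← hF.map_adj, ← F.map_comp, hf.2, F.map_id]

end Functors

/-! ### The 2-category of unitary connections -/

/-- A 0-cell: a sequence of `*`-linear bi-faithful functors between finite semisimple
C*-categories. `Γ.fn k : M k ⥤ M (k + 1)` is the functor usually written `Γ_{k+1}`. -/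
structure ZeroCell where
  M : ℕ → Type u
  [cat : ∀ k, Category.{v} (M k)]
  [cstar : ∀ k, CStarCategory (M k)]
  [semisimple : ∀ k, FiniteSemisimple (M k)]
  fn : ∀ k, M k ⥤ M (k + 1)
  isStarBiFaithful : ∀ k, IsStarBiFaithful (fn k)

attribute [instance] ZeroCell.cat ZeroCell.cstar ZeroCell.semisimple

/-- The object `Γ_k ⋯ Γ_1 m₀` of `M k`. -/
def ZeroCell.tower (Γ : ZeroCell.{u, v}) (m₀ : Γ.M 0) : ∀ k, Γ.M k
  | 0 => m₀
  | k + 1 => (Γ.fn k).obj (Γ.tower m₀ k)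

/-- A 1-cell: `*`-linear bi-faithful functors `Λ_k`, with a unitary connection
`W_{k+1} : Δ_{k+1} Λ_k → Λ_{k+1} Γ_{k+1}`. -/
structure OneCell (Γ Δ : ZeroCell.{u, v}) where
  fn : ∀ k, Γ.M k ⥤ Δ.M k
  isStarBiFaithful : ∀ k, IsStarBiFaithful (fn k)
  W : ∀ k, fn k ⋙ Δ.fn k ⟶ Γ.fn k ⋙ fn (k + 1)
  unitary : ∀ k X, IsUnitary ((W k).app X)

/-- The identity 1-cell. -/
def OneCell.id (Γ : ZeroCell.{u, v}) : OneCell Γ Γ where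
  fn k := 𝟭 (Γ.M k)
  isStarBiFaithful _ := IsStarBiFaithful.id
  W k := { app := fun X => 𝟙 ((Γ.fn k).obj X) }
  unitary _ _ := IsUnitary.id _

/-- The tensor product `Ω ⊠ Λ` of 1-cells: the functors `Ω_k Λ_k`, with the composite connection. -/
def OneCell.tensor {Γ Δ Ξ : ZeroCell.{u, v}} (Ω : OneCell Δ Ξ) (Λ : OneCell Γ Δ) :
    OneCell Γ Ξ where
  fn k := Λ.fn k ⋙ Ω.fn k
  isStarBiFaithful k := (Λ.isStarBiFaithful k).comp (Ω.isStarBiFaithful k)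
  W k :=
    { app := fun X => (Ω.W k).app ((Λ.fn k).obj X) ≫ (Ω.fn (k + 1)).map ((Λ.W k).app X)
      naturality := fun X Y f => by
        have h1 := (Ω.W k).naturality ((Λ.fn k).map f)
        have h2 := (Λ.W k).naturality f
        simp only [Functor.comp_map, Functor.comp_obj] at h1 h2 ⊢
        rw [← Category.assoc, h1, Category.assoc, ← Functor.map_comp, h2, Functor.map_comp,
          Category.assoc] }
  unitary k X := (Ω.unitary k _).comp ((Λ.unitary k X).map (Ω.isStarBiFaithful (k + 1)))

/-- The exchange relation for a pair `(η, κ)` of natural transformations at levels `k`, `k + 1`. -/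
def Exchange {Γ Δ : ZeroCell.{u, v}} (Λ Ω : OneCell Γ Δ) (k : ℕ) (η : Λ.fn k ⟶ Ω.fn k)
    (κ : Λ.fn (k + 1) ⟶ Ω.fn (k + 1)) : Prop :=
  ∀ X : Γ.M k, (Δ.fn k).map (η.app X) ≫ (Ω.W k).app X =
    (Λ.W k).app X ≫ κ.app ((Γ.fn k).obj X)

/-- A representative of a 2-cell: a sequence of natural transformations such that consecutive
terms eventually satisfy the exchange relation. Two representatives define the same 2-cell iff they
are eventually equal, so an equation between 2-cells is an equation that holds at all large
levels. -/
structure TwoCell {Γ Δ : ZeroCell.{u, v}} (Λ Ω : OneCell Γ Δ) where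
  app : ∀ k, Λ.fn k ⟶ Ω.fn k
  exchange : ∃ N, ∀ k, N ≤ k → Exchange Λ Ω k (app k) (app (k + 1))

/-! ### Q-systems -/

/-- The Q-system axioms for an endofunctor `F` with `m : F F → F` and `i : id → F`; they are
written out on components, and the adjoint of a natural transformation is taken componentwise.
`m ⊠ 1` has components `m.app (F.obj X)`, and `1 ⊠ m` has components `F.map (m.app X)`. -/
structure IsQSystem {C : Type u} [Category.{v} C] [CStarCategory C] (F : C ⥤ C)
    (m : F ⋙ F ⟶ F) (i : 𝟭 C ⟶ F) : Prop where
  assoc : ∀ X, m.app (F.obj X) ≫ m.app X = F.map (m.app X) ≫ m.app X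
  unit_left : ∀ X, i.app (F.obj X) ≫ m.app X = 𝟙 (F.obj X)
  unit_right : ∀ X, F.map (i.app X) ≫ m.app X = 𝟙 (F.obj X)
  frobenius_left : ∀ X, F.map (adj (m.app X)) ≫ m.app (F.obj X) = m.app X ≫ adj (m.app X)
  frobenius_right : ∀ X, adj (m.app (F.obj X)) ≫ F.map (m.app X) = m.app X ≫ adj (m.app X)
  separable : ∀ X, adj (m.app X) ≫ m.app X = 𝟙 (F.obj X)

/-- A Q-system on the 0-cell `Γ` (with representatives chosen for its multiplication and unit
2-cells): the Q-system axioms hold as equations of 2-cells, that is, at all large levels. -/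
structure QSystem (Γ : ZeroCell.{u, v}) where
  Q : OneCell Γ Γ
  m : TwoCell (Q.tensor Q) Q
  i : TwoCell (OneCell.id Γ) Q
  isQSystem : ∃ N, ∀ k, N ≤ k → IsQSystem (Q.fn k) (m.app k) (i.app k)

namespace QSystem

variable {Γ : ZeroCell.{u, v}} (Q : QSystem Γ) (m₀ : Γ.M 0) (k : ℕ)

/-- From level `l` on, `m_k` and `i_k` satisfy the Q-system axioms and the exchange relations. -/
def HoldsFrom (l : ℕ) : Prop :=
  ∀ k, l ≤ k → IsQSystem (Q.Q.fn k) (Q.m.app k) (Q.i.app k) ∧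
    Exchange (Q.Q.tensor Q.Q) Q.Q k (Q.m.app k) (Q.m.app (k + 1)) ∧
    Exchange (OneCell.id Γ) Q.Q k (Q.i.app k) (Q.i.app (k + 1))

/-- The object `Q_k Γ_k ⋯ Γ_1 m₀`. -/
abbrev QTower : Γ.M k := (Q.Q.fn k).obj (Γ.tower m₀ k)

/-- The component of `m_k` at `Γ_k ⋯ Γ_1 m₀`. -/
abbrev mAt : (Q.Q.fn k).obj (Q.QTower m₀ k) ⟶ Q.QTower m₀ k := (Q.m.app k).app (Γ.tower m₀ k)

/-- The component of `i_k` at `Γ_k ⋯ Γ_1 m₀`. -/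
abbrev iAt : Γ.tower m₀ k ⟶ Q.QTower m₀ k := (Q.i.app k).app (Γ.tower m₀ k)

/-- The algebra `A_k = End (Γ_k ⋯ Γ_1 m₀)`. -/
abbrev A : Type v := End (Γ.tower m₀ k)

/-- The space `H_k = M_k(Γ_k ⋯ Γ_1 m₀, Q_k Γ_k ⋯ Γ_1 m₀)`. -/
abbrev H : Type v := Γ.tower m₀ k ⟶ Q.QTower m₀ k

/-- The space `Y_k = M_k(Γ_k ⋯ Γ_1 m₀, Q_k Q_k Γ_k ⋯ Γ_1 m₀)`. -/
abbrev Y : Type v := Γ.tower m₀ k ⟶ (Q.Q.fn k).obj (Q.QTower m₀ k)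

/-- The left action of `A_k` on `H_k`: `a · ξ = Q_k(a) ∘ ξ`. -/
def leftAct (a : A m₀ k) (ξ : Q.H m₀ k) : Q.H m₀ k := ξ ≫ (Q.Q.fn k).map a

/-- The right action of `A_k` on `H_k`: `ξ · a = ξ ∘ a`. -/
def rightAct (ξ : Q.H m₀ k) (a : A m₀ k) : Q.H m₀ k := CategoryStruct.comp (X := Γ.tower m₀ k) a ξ

/-- The subspace of `H_k ⊗ H_k` spanned by all `ξ a ⊗ η - ξ ⊗ a η` with `a ∈ A_k`. -/
def balanced : Submodule ℂ (Q.H m₀ k ⊗[ℂ] Q.H m₀ k) :=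
  Submodule.span ℂ {t | ∃ (ξ η : Q.H m₀ k) (a : A m₀ k),
    t = Q.rightAct m₀ k ξ a ⊗ₜ[ℂ] η - ξ ⊗ₜ[ℂ] Q.leftAct m₀ k a η}

/-- The relative tensor product `H_k ⊠_{A_k} H_k` (all spaces are finite-dimensional, so there is
nothing to complete). -/
abbrev HH : Type v := (Q.H m₀ k ⊗[ℂ] Q.H m₀ k) ⧸ Q.balanced m₀ k

/-- The elementary tensor `ξ ⊠ η`. -/
def tmul (ξ η : Q.H m₀ k) : Q.HH m₀ k := (Q.balanced m₀ k).mkQ (ξ ⊗ₜ[ℂ] η)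

/-- The identification map `H_k ⊠_{A_k} H_k → Y_k`, `ξ ⊠ η ↦ Q_k(ξ) ∘ η`. -/
noncomputable def fusion : Q.HH m₀ k →ₗ[ℂ] Q.Y m₀ k :=
  (Q.balanced m₀ k).liftQ
    (TensorProduct.lift (LinearMap.mk₂ ℂ
      (fun ξ η : Q.H m₀ k => (η ≫ (Q.Q.fn k).map ξ : Q.Y m₀ k))
      (fun ξ ξ' η => by rw [(Q.Q.isStarBiFaithful k).map_add, Preadditive.comp_add])
      (fun c ξ η => by rw [(Q.Q.isStarBiFaithful k).map_smul, Linear.comp_smul])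
      (fun ξ η η' => by rw [Preadditive.add_comp])
      (fun c ξ η => by rw [Linear.smul_comp])))
    (by
      rw [balanced, Submodule.span_le]
      rintro t ⟨ξ, η, a, rfl⟩
      simp [leftAct, rightAct])

/-- The map `m̃_k : H_k ⊠_{A_k} H_k → H_k` induced by `m_k`. -/
noncomputable def mTilde : Q.HH m₀ k →ₗ[ℂ] Q.H m₀ k :=
  Linear.rightComp ℂ (Γ.tower m₀ k) (Q.mAt m₀ k) ∘ₗ Q.fusion m₀ k

theorem mTilde_tmul (ξ η : Q.H m₀ k) :
    Q.mTilde m₀ k (Q.tmul m₀ k ξ η) = (η ≫ (Q.Q.fn k).map ξ) ≫ Q.mAt m₀ k := rfl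

/-- The involution `ξ† = Q_k(ξ*) ∘ m_k* ∘ i_k` on `H_k`. -/
def dagger (ξ : Q.H m₀ k) : Q.H m₀ k :=
  Q.iAt m₀ k ≫ adj (Q.mAt m₀ k) ≫ (Q.Q.fn k).map (adj ξ)

/-- The set `S_k` of all `x ∈ End (Q_k Γ_k ⋯ Γ_1 m₀)` with `m_k ∘ Q_k(x) = x ∘ m_k`. -/
def S : Set (End (Q.QTower m₀ k)) :=
  {x | (Q.Q.fn k).map x ≫ Q.mAt m₀ k =
    CategoryStruct.comp (Z := Q.QTower m₀ k) (Q.mAt m₀ k) x}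

/-- The map `φ₁ : H_k → End (Q_k Γ_k ⋯ Γ_1 m₀)`, `ξ ↦ m_k ∘ Q_k(ξ)`. -/
def phi₁ (ξ : Q.H m₀ k) : End (Q.QTower m₀ k) := (Q.Q.fn k).map ξ ≫ Q.mAt m₀ k

/-- The map `φ₂ : End (Q_k Γ_k ⋯ Γ_1 m₀) → H_k`, `x ↦ x ∘ i_k`. -/
def phi₂ (x : End (Q.QTower m₀ k)) : Q.H m₀ k :=
  CategoryStruct.comp (Y := Q.QTower m₀ k) (Q.iAt m₀ k) x

/-- A copy of the set `H_k`, without any structure. -/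
def HAlg : Type v := Q.H m₀ k

/-- The identity map from the copy `HAlg` to `H_k`. -/
def toH : Q.HAlg m₀ k ≃ Q.H m₀ k := Equiv.refl _

end QSystem

end UC

/-!
Write `F = Q_k`, `X = Γ_k ⋯ Γ_1 m₀`, and `m : F F X ⟶ F X`, `i : X ⟶ F X` for the components of the
Q-system at `X`. In categorical terms `F X` is the free `m`-module on `X`, the set `S_k` consists of
its module endomorphisms, and `φ₁ : ξ ↦ F ξ ≫ m` is the usual bijection between maps `X ⟶ F X` and
module maps `F X ⟶ F X`, with inverse `x ↦ i ≫ x` (`phi₁_mem_S`, `phi₂_phi₁`, `phi₁_phi₂`). This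
uses only the monad laws of `(m, i)`. Module endomorphisms are closed under composition, and by the
Frobenius and separability laws they are closed under adjoints (`adj_mem_S`), so `S_k` is a unital
`*`-subalgebra of the finite-dimensional C*-algebra `End (F X)`.

The C*-algebra structure of `S_k` is then carried over to `H_k` along this bijection. The
multiplication and the involution obtained in this way are the ones in the statement: `φ₂ (x y)`
is `m̃ (φ₂ x ⊠ φ₂ y)` (`phi₂_mul`), and `ξ†` is `φ₂ (φ₁ ξ)*` (`phi₂_adj_phi₁`). Finite-dimensionality
gives completeness.
-/

namespace UC

/-! ### The norm of a C*-category -/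

section Norm

variable {C : Type u} [Category.{v} C] [CStarCategory C]

theorem hnorm_zero (X Y : C) : hnorm (0 : X ⟶ Y) = 0 := by
  simpa using CStarCategory.hnorm_smul (0 : ℂ) (0 : X ⟶ Y)

theorem hnorm_neg {X Y : C} (f : X ⟶ Y) : hnorm (-f) = hnorm f := by
  simpa using CStarCategory.hnorm_smul (-1 : ℂ) f

/-- The norm of `End X`, as a ring norm. -/
def endRingNorm (X : C) : RingNorm (End X) where
  toFun f := hnorm (X := X) (Y := X) f
  map_zero' := hnorm_zero X X
  add_le' f g := CStarCategory.hnorm_add_le (X := X) (Y := X) f g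
  neg' f := hnorm_neg (X := X) (Y := X) f
  mul_le' f g := (CStarCategory.hnorm_comp_le (X := X) (Y := X) (Z := X) g f).trans_eq
    (mul_comm _ _)
  eq_zero_of_map_eq_zero' f := CStarCategory.eq_zero_of_hnorm (X := X) (Y := X) f

theorem endRingNorm_smul (X : C) (c : ℂ) (f : End X) :
    endRingNorm X (c • f) = ‖c‖ * endRingNorm X f :=
  CStarCategory.hnorm_smul (X := X) (Y := X) c f

theorem endRingNorm_star_mul_self (X : C) (f : End X) :
    endRingNorm X (star f * f) = endRingNorm X f * endRingNorm X f :=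
  CStarCategory.hnorm_comp_adj (X := X) (Y := X) f

end Norm

/-! ### Transport of C*-algebra structures -/

section Transport

variable {T A : Type*} [Ring A] [StarRing A] [Algebra ℂ A] [StarModule ℂ A]
  [FiniteDimensional ℂ A]

/-- The C*-algebra structure on a set `T` transported along a bijection with a finite-dimensional
`*`-algebra `A` that carries a C*-norm `N`. -/
@[reducible]
noncomputable def cstarAlgebraOfEquiv (e : T ≃ A) (N : RingNorm A)
    (N_smul : ∀ (c : ℂ) (a : A), N (c • a) = ‖c‖ * N a)
    (N_star : ∀ a : A, N (star a * a) = N a * N a) : CStarAlgebra T :=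
  letI : Ring T := e.ring
  letI : Algebra ℂ T := e.algebra ℂ
  let E : T ≃ₐ[ℂ] A := e.algEquiv ℂ
  letI : NormedRing T := RingNorm.toNormedRing
    { toFun := fun t => N (E t)
      map_zero' := by simp
      add_le' := fun s t => by simpa using map_add_le_add N (E s) (E t)
      neg' := fun t => by simp
      mul_le' := fun s t => by simpa using map_mul_le_mul N (E s) (E t)
      eq_zero_of_map_eq_zero' := fun t ht => by
        simpa using N.eq_zero_of_map_eq_zero' (E t) ht }
  letI : NormedAlgebra ℂ T :=
    { (inferInstance : Algebra ℂ T) with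
      norm_smul_le := fun c t => by
        change N (E (c • t)) ≤ ‖c‖ * N (E t)
        rw [map_smul, N_smul] }
  letI : StarRing T :=
    { star := fun t => E.symm (star (E t))
      star_involutive := fun t => by simp
      star_mul := fun s t => by
        apply E.injective
        change E (E.symm (star (E (s * t)))) = E (E.symm (star (E t)) * E.symm (star (E s)))
        simp
      star_add := fun s t => by
        apply E.injective
        change E (E.symm (star (E (s + t)))) = E (E.symm (star (E s)) + E.symm (star (E t)))
        simp }
  { (inferInstance : NormedRing T), (inferInstance : StarRing T),
    (inferInstance : NormedAlgebra ℂ T) with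
    complete := fun {f} hf => by
      have : FiniteDimensional ℂ T := E.symm.toLinearEquiv.finiteDimensional
      exact (FiniteDimensional.complete ℂ T).complete hf
    norm_mul_self_le := fun t => by
      change N (E t) * N (E t) ≤ N (E (E.symm (star (E t)) * t))
      rw [map_mul, AlgEquiv.apply_symm_apply, N_star]
    star_smul := fun c t => by
      apply E.injective
      change E (E.symm (star (E (c • t)))) = E (star c • E.symm (star (E t)))
      simp }

end Transport

/-! ### The free module on the tower and its endomorphisms -/

namespace QSystem

variable {Γ : ZeroCell.{u, v}} {Q : QSystem Γ} {m₀ : Γ.M 0} {k : ℕ}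

theorem phi₁_mem_S (h : IsQSystem (Q.Q.fn k) (Q.m.app k) (Q.i.app k)) (ξ : Q.H m₀ k) :
    Q.phi₁ m₀ k ξ ∈ Q.S m₀ k := by
  let F := Q.Q.fn k
  let m : F.obj (Q.QTower m₀ k) ⟶ Q.QTower m₀ k := Q.mAt m₀ k
  let M : F.obj (F.obj (Q.QTower m₀ k)) ⟶ F.obj (Q.QTower m₀ k) :=
    (Q.m.app k).app (Q.QTower m₀ k)
  have hn : F.map (F.map ξ) ≫ M = m ≫ F.map ξ := (Q.m.app k).naturality ξ
  have ha : M ≫ m = F.map m ≫ m := h.assoc (Γ.tower m₀ k)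
  change F.map (F.map ξ ≫ m) ≫ m = m ≫ F.map ξ ≫ m
  rw [Functor.map_comp, Category.assoc, ← ha, ← Category.assoc, hn, Category.assoc]

theorem phi₂_phi₁ (h : IsQSystem (Q.Q.fn k) (Q.m.app k) (Q.i.app k)) (ξ : Q.H m₀ k) :
    Q.phi₂ m₀ k (Q.phi₁ m₀ k ξ) = ξ := by
  let F := Q.Q.fn k
  let m : F.obj (Q.QTower m₀ k) ⟶ Q.QTower m₀ k := Q.mAt m₀ k
  let I : Q.QTower m₀ k ⟶ F.obj (Q.QTower m₀ k) := (Q.i.app k).app (Q.QTower m₀ k)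
  have hn : ξ ≫ I = Q.iAt m₀ k ≫ F.map ξ := (Q.i.app k).naturality ξ
  have hu : I ≫ m = 𝟙 _ := h.unit_left (Γ.tower m₀ k)
  change Q.iAt m₀ k ≫ F.map ξ ≫ m = ξ
  rw [← Category.assoc, ← hn, Category.assoc, hu, Category.comp_id]

theorem phi₁_phi₂ (h : IsQSystem (Q.Q.fn k) (Q.m.app k) (Q.i.app k))
    {x : Q.QTower m₀ k ⟶ Q.QTower m₀ k} (hx : x ∈ Q.S m₀ k) :
    Q.phi₁ m₀ k (Q.phi₂ m₀ k x) = x := by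
  let F := Q.Q.fn k
  let m : F.obj (Q.QTower m₀ k) ⟶ Q.QTower m₀ k := Q.mAt m₀ k
  have hu : F.map (Q.iAt m₀ k) ≫ m = 𝟙 _ := h.unit_right (Γ.tower m₀ k)
  have hx' : F.map x ≫ m = m ≫ x := hx
  change F.map (Q.iAt m₀ k ≫ x) ≫ m = x
  rw [Functor.map_comp, Category.assoc, hx', ← Category.assoc, hu, Category.id_comp]

/-- The adjoint of a module endomorphism is a module endomorphism: by separability
`m ≫ x* = m ≫ x* ≫ m* ≫ m`, where `x* ≫ m* = m* ≫ F x*`, and the Frobenius law moves `m` past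
`m*`. -/
theorem adj_mem_S (h : IsQSystem (Q.Q.fn k) (Q.m.app k) (Q.i.app k))
    {x : Q.QTower m₀ k ⟶ Q.QTower m₀ k} (hx : x ∈ Q.S m₀ k) : adj x ∈ Q.S m₀ k := by
  let F := Q.Q.fn k
  let m : F.obj (Q.QTower m₀ k) ⟶ Q.QTower m₀ k := Q.mAt m₀ k
  let M : F.obj (F.obj (Q.QTower m₀ k)) ⟶ F.obj (Q.QTower m₀ k) :=
    (Q.m.app k).app (Q.QTower m₀ k)
  let y : Q.QTower m₀ k ⟶ Q.QTower m₀ k := adj x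
  have hn : F.map (F.map y) ≫ M = M ≫ F.map y := (Q.m.app k).naturality y
  have ha : M ≫ m = F.map m ≫ m := h.assoc (Γ.tower m₀ k)
  have hs : adj m ≫ m = 𝟙 _ := h.separable (Γ.tower m₀ k)
  have hf : F.map (adj m) ≫ M = m ≫ adj m := h.frobenius_left (Γ.tower m₀ k)
  have hxy : y ≫ adj m = adj m ≫ F.map y := by
    have hx' : F.map x ≫ m = m ≫ x := hx
    rw [← CStarCategory.adj_comp m x, ← hx', CStarCategory.adj_comp,
      (Q.Q.isStarBiFaithful k).map_adj]
  change F.map y ≫ m = m ≫ y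
  calc F.map y ≫ m = F.map (y ≫ adj m ≫ m) ≫ m := by rw [hs, Category.comp_id]
    _ = F.map (adj m) ≫ F.map (F.map y) ≫ F.map m ≫ m := by
      rw [← Category.assoc, hxy]; simp only [Functor.map_comp, Category.assoc]
    _ = F.map (adj m) ≫ (F.map (F.map y) ≫ M) ≫ m := by rw [← ha, Category.assoc]
    _ = (F.map (adj m) ≫ M) ≫ F.map y ≫ m := by rw [hn]; simp only [Category.assoc]
    _ = m ≫ (adj m ≫ F.map y) ≫ m := by rw [hf]; simp only [Category.assoc]
    _ = m ≫ y := by rw [← hxy, Category.assoc, hs, Category.comp_id]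

theorem mTilde_tmul_eq_comp_phi₁ (ξ η : Q.H m₀ k) :
    Q.mTilde m₀ k (Q.tmul m₀ k ξ η) =
      CategoryStruct.comp (Y := Q.QTower m₀ k) (Z := Q.QTower m₀ k) η (Q.phi₁ m₀ k ξ) :=
  Category.assoc _ _ _

theorem phi₂_mul (h : IsQSystem (Q.Q.fn k) (Q.m.app k) (Q.i.app k))
    {x : End (Q.QTower m₀ k)} (hx : x ∈ Q.S m₀ k) (y : End (Q.QTower m₀ k)) :
    Q.phi₂ m₀ k (x * y) =
      Q.mTilde m₀ k (Q.tmul m₀ k (Q.phi₂ m₀ k x) (Q.phi₂ m₀ k y)) := by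
  rw [mTilde_tmul_eq_comp_phi₁, phi₁_phi₂ h hx]
  exact (Category.assoc _ _ _).symm

theorem phi₂_adj_phi₁ (ξ : Q.H m₀ k) :
    Q.phi₂ m₀ k (star (Q.phi₁ m₀ k ξ)) = Q.dagger m₀ k ξ := by
  change Q.iAt m₀ k ≫ adj ((Q.Q.fn k).map ξ ≫ Q.mAt m₀ k) = _
  rw [adj, CStarCategory.adj_comp, ← adj, ← adj, ← (Q.Q.isStarBiFaithful k).map_adj]
  rfl

variable (m₀) in
/-- The module endomorphisms `S_k`, as a unital `*`-subalgebra of `End (Q_k Γ_k ⋯ Γ_1 m₀)`. -/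
def starSubalgebraS (h : IsQSystem (Q.Q.fn k) (Q.m.app k) (Q.i.app k)) :
    StarSubalgebra ℂ (End (Q.QTower m₀ k)) where
  carrier := Q.S m₀ k
  mul_mem' {x y} hx hy := by
    let F := Q.Q.fn k
    let m : F.obj (Q.QTower m₀ k) ⟶ Q.QTower m₀ k := Q.mAt m₀ k
    let x' : Q.QTower m₀ k ⟶ Q.QTower m₀ k := x
    let y' : Q.QTower m₀ k ⟶ Q.QTower m₀ k := y
    have hx' : F.map x' ≫ m = m ≫ x' := hx
    have hy' : F.map y' ≫ m = m ≫ y' := hy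
    change F.map (y' ≫ x') ≫ m = m ≫ y' ≫ x'
    rw [Functor.map_comp, Category.assoc, hx', ← Category.assoc, hy', Category.assoc]
  add_mem' {x y} hx hy := by
    let F := Q.Q.fn k
    let m : F.obj (Q.QTower m₀ k) ⟶ Q.QTower m₀ k := Q.mAt m₀ k
    let x' : Q.QTower m₀ k ⟶ Q.QTower m₀ k := x
    let y' : Q.QTower m₀ k ⟶ Q.QTower m₀ k := y
    have hx' : F.map x' ≫ m = m ≫ x' := hx
    have hy' : F.map y' ≫ m = m ≫ y' := hy
    change F.map (x' + y') ≫ m = m ≫ (x' + y')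
    rw [(Q.Q.isStarBiFaithful k).map_add, Preadditive.add_comp, Preadditive.comp_add, hx', hy']
  algebraMap_mem' c := by
    let F := Q.Q.fn k
    let m : F.obj (Q.QTower m₀ k) ⟶ Q.QTower m₀ k := Q.mAt m₀ k
    change F.map (c • 𝟙 (Q.QTower m₀ k)) ≫ m = m ≫ (c • 𝟙 (Q.QTower m₀ k))
    rw [(Q.Q.isStarBiFaithful k).map_smul, Linear.smul_comp, Linear.comp_smul,
      CategoryTheory.Functor.map_id, Category.id_comp, Category.comp_id]
  star_mem' hx := adj_mem_S h hx

variable (m₀) in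
/-- The bijection `φ₁ : H_k → S_k`, with inverse `φ₂`. -/
def equivS (h : IsQSystem (Q.Q.fn k) (Q.m.app k) (Q.i.app k)) :
    Q.HAlg m₀ k ≃ starSubalgebraS m₀ h where
  toFun ξ := ⟨Q.phi₁ m₀ k (Q.toH m₀ k ξ), phi₁_mem_S h _⟩
  invFun x := (Q.toH m₀ k).symm (Q.phi₂ m₀ k x)
  left_inv ξ := phi₂_phi₁ h (Q.toH m₀ k ξ)
  right_inv x := Subtype.ext (phi₁_phi₂ h x.2)

end QSystem

end UC

theorem mainTheorem2 (Γ : UC.ZeroCell.{u, v}) (Q : UC.QSystem Γ)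
    (m₀ : Γ.M 0) (hm₀ : UC.IsSumOfAllSimples m₀)
    (l : ℕ) (hl : Q.HoldsFrom l) (k : ℕ) (hk : l ≤ k) :
    ∃ _inst : CStarAlgebra (Q.HAlg m₀ k),
      (∀ ξ η : Q.HAlg m₀ k, Q.toH m₀ k (ξ + η) = Q.toH m₀ k ξ + Q.toH m₀ k η) ∧
      (∀ (c : ℂ) (ξ : Q.HAlg m₀ k), Q.toH m₀ k (c • ξ) = c • Q.toH m₀ k ξ) ∧
      (∀ ξ η : Q.HAlg m₀ k, Q.toH m₀ k (ξ * η) =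
        Q.mTilde m₀ k (Q.tmul m₀ k (Q.toH m₀ k ξ) (Q.toH m₀ k η))) ∧
      (∀ ξ : Q.HAlg m₀ k, Q.toH m₀ k (star ξ) = Q.dagger m₀ k (Q.toH m₀ k ξ)) ∧
      Q.toH m₀ k 1 = Q.iAt m₀ k ∧
      ∃ S : StarSubalgebra ℂ (End (Q.QTower m₀ k)), (S : Set (End (Q.QTower m₀ k))) = Q.S m₀ k ∧
        ∃ φ : Q.HAlg m₀ k ≃⋆ₐ[ℂ] S,
          (∀ ξ : Q.HAlg m₀ k, (φ ξ : End (Q.QTower m₀ k)) = Q.phi₁ m₀ k (Q.toH m₀ k ξ)) ∧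
          (∀ x : S, Q.toH m₀ k (φ.symm x) = Q.phi₂ m₀ k (x : End (Q.QTower m₀ k))) ∧
          ∀ ξ : Q.HAlg m₀ k, ‖ξ‖ = UC.hnorm (X := Q.QTower m₀ k) (φ ξ : End (Q.QTower m₀ k)) := by
  have h := (hl k hk).1
  let S := UC.QSystem.starSubalgebraS m₀ h
  let e : Q.HAlg m₀ k ≃ S := UC.QSystem.equivS m₀ h
  let N₀ := UC.endRingNorm (Q.QTower m₀ k)
  let N : RingNorm S :=
    { toFun := fun x => N₀ x
      map_zero' := map_zero N₀
      add_le' := fun x y => map_add_le_add N₀ (x : End (Q.QTower m₀ k)) y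
      neg' := fun x => map_neg_eq_map N₀ (x : End (Q.QTower m₀ k))
      mul_le' := fun x y => map_mul_le_mul N₀ (x : End (Q.QTower m₀ k)) y
      eq_zero_of_map_eq_zero' := fun x hx => Subtype.ext (N₀.eq_zero_of_map_eq_zero' _ hx) }
  have : FiniteDimensional ℂ (End (Q.QTower m₀ k)) :=
    UC.FiniteSemisimple.finiteDimensional (Q.QTower m₀ k) (Q.QTower m₀ k)
  have : FiniteDimensional ℂ S :=
    inferInstanceAs (FiniteDimensional ℂ (Subalgebra.toSubmodule S.toSubalgebra))
  let inst : CStarAlgebra (Q.HAlg m₀ k) := UC.cstarAlgebraOfEquiv e N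
    (fun c x => UC.endRingNorm_smul _ c (x : End (Q.QTower m₀ k)))
    (fun x => UC.endRingNorm_star_mul_self _ (x : End (Q.QTower m₀ k)))
  let φ : Q.HAlg m₀ k ≃⋆ₐ[ℂ] S :=
    { e with
      map_mul' := fun ξ η => e.apply_symm_apply (e ξ * e η)
      map_add' := fun ξ η => e.apply_symm_apply (e ξ + e η)
      map_smul' := fun c ξ => e.apply_symm_apply (c • e ξ)
      map_star' := fun ξ => e.apply_symm_apply (star (e ξ)) }
  have φ_symm (x : S) : Q.toH m₀ k (φ.symm x) = Q.phi₂ m₀ k (x : End (Q.QTower m₀ k)) := rfl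
  have φ_coe (ξ : Q.HAlg m₀ k) :
      (φ ξ : End (Q.QTower m₀ k)) = Q.phi₁ m₀ k (Q.toH m₀ k ξ) := rfl
  have φ₂_φ (ξ : Q.HAlg m₀ k) :
      Q.phi₂ m₀ k (φ ξ : End (Q.QTower m₀ k)) = Q.toH m₀ k ξ :=
    UC.QSystem.phi₂_phi₁ h (Q.toH m₀ k ξ)
  refine ⟨inst, fun ξ η => ?_, fun c ξ => ?_, fun ξ η => ?_, fun ξ => ?_, ?_, S, rfl, φ, φ_coe,
    φ_symm, fun ξ => rfl⟩
  · rw [← φ₂_φ (ξ + η), map_add]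
    exact (Preadditive.comp_add ..).trans (congrArg₂ _ (φ₂_φ ξ) (φ₂_φ η))
  · rw [← φ₂_φ (c • ξ), map_smul]
    exact (Linear.comp_smul ..).trans (congrArg _ (φ₂_φ ξ))
  · rw [← φ₂_φ (ξ * η), map_mul]
    refine (UC.QSystem.phi₂_mul h (φ ξ).2 _).trans ?_
    rw [φ₂_φ, φ₂_φ]
  · rw [← φ₂_φ (star ξ), map_star]
    exact UC.QSystem.phi₂_adj_phi₁ _
  · rw [← φ₂_φ 1, map_one]
    exact Category.comp_id _
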